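/- Throughout, a semigroup is nonempty, and $S$ denotes a finite commutative semigroup, written additively. A *sequence* over $S$ is a finite multiset $A$ of elements of $S$; $|A|$ is its length and $\sigma(A)$ the sum of its terms. If $S$ has an identity element $0_S$, the empty sequence is allowed and has sum $0_S$; otherwise only nonempty sequences are considered. The *period* of $a\in S$ is the least $t\ge 1$ such that $ra=(r+t)a$ for some $r\ge 1$, $\exp(S)$ is the least common multiple of the periods of all elements of $S$, and $$\kappa(S)=\left\lceil\frac{|S|}{\exp(S)}\right\rceil\exp(S).$$ Let $\mathsf D(S)$ be the least positive integer $\ell$ such that every sequence $A$ over $S$ with $|A|\ge \ell$ has a proper subsequence $B$ with $\sigma(B)=\sigma(A)$. Let $\mathsf E(S)$ be the least positive integer $\ell$ such that every sequence $A$ over $S$ with $|A|=\ell$ has a subsequence $B$ with $\sigma(B)=\sigma(A)$ and $|A|-|B|=\kappa(S)$. $S$ is *subdirectly irreducible* if, whenever $S$ is a subdirect product of a nonempty family of commutative semigroups, one of the projections is an isomorphism. $S$ is a *nilsemigroup* if it has a zero element $\infty$ (that is, $\infty+a=\infty$ for all $a$) and every $x\in S$ satisfies $nx=\infty$ for some $n\ge1$.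 $S$ is *elementary* if it is a disjoint union $G\cup N$ of a group $G$ and a nilsemigroup $N$, where $N$ is an ideal of $S$, the zero element of $N$ is the zero element of $S$, and the identity element of $G$ is the identity element of $S$. **Theorem.** Let $S$ be a subdirectly irreducible finite commutative semigroup. Then $$\mathsf E(S)\le \mathsf D(S)+\kappa(S)-1.$$ Moreover, $S$ is a nilsemigroup, an abelian group, or an elementary semigroup; and if $S$ has an identity element (in particular, if $S$ is an abelian group or an elementary semigroup), then $$\mathsf E(S)=\mathsf D(S)+\kappa(S)-1.$$ -/

import Mathlib

universe u

namespace SemigroupZeroSum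

/-- `e` is the identity element `0_S` of `S`. -/
def IsIdentityElt {S : Type u} [AddCommSemigroup S] (e : S) : Prop := ∀ a : S, e + a = a

/-- `z` is the zero (absorbing) element `∞_S` of `S`. -/
def IsZeroElt {S : Type u} [AddCommSemigroup S] (z : S) : Prop := ∀ a : S, z + a = z

open Classical in
/-- The sum `σ(A)` of a sequence over `S`, i.e. of an element `A` of the free commutative monoid
with basis `S`, represented by a finite multiset. The value lies in `S ∪ {0}`, where `0` is a new
identity element. The sum of a nonempty sequence is its sum in `S`. The empty sum is the identity
element of `S` if there is one; otherwise it is the new element `0`, which is the sum of no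
nonempty sequence. -/
noncomputable def sigma {S : Type u} [AddCommSemigroup S] (A : Multiset S) : WithZero S :=
  if h : A = 0 ∧ ∃ e : S, IsIdentityElt e then ((h.2.choose : S) : WithZero S)
  else (A.map (fun a : S => (a : WithZero S))).sum

/-- A sequence `A` is reducible if some proper subsequence of it has the same sum. -/
def IsReducible {S : Type u} [AddCommSemigroup S] (A : Multiset S) : Prop :=
  ∃ B : Multiset S, B < A ∧ sigma B = sigma A

/-- The (large) Davenport constant: the least positive integer `ℓ` (or `∞`) such that every
sequence of length at least `ℓ` is reducible. -/
noncomputable def davenport (S : Type u) [AddCommSemigroup S] : ℕ∞ :=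
  sInf ((fun ℓ : ℕ => (ℓ : ℕ∞)) ''
    {ℓ : ℕ | 0 < ℓ ∧ ∀ A : Multiset S, ℓ ≤ A.card → IsReducible A})

/-- The period of `a`: the least positive `t` with `r a = (r + t) a` for some `r > 0`.
(Positive multiples of `a` are the same in `S` and in `S ∪ {0}`.) -/
noncomputable def period {S : Type u} [AddCommSemigroup S] (a : S) : ℕ :=
  sInf {t : ℕ | 0 < t ∧ ∃ r : ℕ, 0 < r ∧ r • (a : WithZero S) = (r + t) • (a : WithZero S)}

/-- `exp(S)`: the least common multiple of the periods of all elements of `S`. -/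
noncomputable def semigroupExp (S : Type u) [AddCommSemigroup S] [Fintype S] : ℕ :=
  (Finset.univ : Finset S).lcm period

/-- `κ(S) = ⌈|S| / exp(S)⌉ exp(S)`. -/
noncomputable def kappa (S : Type u) [AddCommSemigroup S] [Fintype S] : ℕ :=
  ⌈(Fintype.card S : ℚ) / (semigroupExp S : ℚ)⌉₊ * semigroupExp S

/-- `E(S)`: the least positive integer `ℓ` such that every sequence `A` of length `ℓ` has a
subsequence `B` with `σ(B) = σ(A)` and `|A| - |B| = κ(S)` (and `∞` if there is no such `ℓ`). -/
noncomputable def gaoConstant (S : Type u) [AddCommSemigroup S] [Fintype S] : ℕ∞ :=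
  sInf ((fun ℓ : ℕ => (ℓ : ℕ∞)) ''
    {ℓ : ℕ | 0 < ℓ ∧ ∀ A : Multiset S, A.card = ℓ →
      ∃ B : Multiset S, B ≤ A ∧ sigma B = sigma A ∧ B.card + kappa S = A.card})

/-- `S` is subdirectly irreducible: whenever `S` is a subdirect product of a nonempty family of
commutative semigroups `T i` (the homomorphisms `S → T i` are surjective and together separate the
points of `S`), one of the projections `S → T i` is an isomorphism. -/
def IsSubdirectlyIrreducible (S : Type u) [AddCommSemigroup S] : Prop :=
  ∀ (ι : Type u) [Nonempty ι] (T : ι → Type u) [∀ i, AddCommSemigroup (T i)]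
    (f : ∀ i, S →ₙ+ T i),
    (∀ i, Function.Surjective (f i)) →
    (∀ x y : S, (∀ i, f i x = f i y) → x = y) →
    ∃ i, Function.Bijective (f i)

/-- `S` is a nilsemigroup: it has a zero element, and every element has a positive multiple equal
to it. -/
def IsNilsemigroup (S : Type u) [AddCommSemigroup S] : Prop :=
  ∃ z : S, IsZeroElt z ∧ ∀ x : S, ∃ n : ℕ, 0 < n ∧ n • (x : WithZero S) = (z : WithZero S)

/-- The commutative semigroup `S` is an abelian group. -/
def IsAbelianGroup (S : Type u) [AddCommSemigroup S] : Prop :=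
  ∃ e : S, IsIdentityElt e ∧ ∀ a : S, ∃ b : S, a + b = e

/-- `S` is elementary: it is the disjoint union of a group `G` and a nilsemigroup `N`, where `N` is
an ideal of `S`, the zero element of `N` is the zero element of `S`, and the identity element of
`G` is the identity element of `S`. -/
def IsElementary (S : Type u) [AddCommSemigroup S] : Prop :=
  ∃ G N : Set S, Disjoint G N ∧ G ∪ N = Set.univ ∧
    (∀ a ∈ G, ∀ b ∈ G, a + b ∈ G) ∧
    (∃ e ∈ G, IsIdentityElt e ∧ ∀ a ∈ G, ∃ b ∈ G, a + b = e) ∧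
    (∀ a ∈ N, ∀ s : S, a + s ∈ N) ∧
    (∃ z ∈ N, IsZeroElt z ∧
      ∀ x ∈ N, ∃ n : ℕ, 0 < n ∧ n • (x : WithZero S) = (z : WithZero S))

end SemigroupZeroSum

/-!
Write `D`, `E`, `κ` for `davenport S`, `gaoConstant S`, `kappa S`.

*Structure.* For an idempotent `e`, the congruence `e + x = e + y` and the Rees congruence of the
ideal `e + S` meet in equality. By subdirect irreducibility one of them is equality, so `e` is the
identity or the zero element (`IsSubdirectlyIrreducible.isIdentityElt_or_isZeroElt`). As every
element has an idempotent multiple, it is a unit or nilpotent, and the trichotomy follows.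

*Lower bound.* If `S` has an identity, append `κ - 1` zeros to an irreducible sequence
(`davenport_add_kappa_sub_one_le`).

*Upper bound.* Let `|A| = D + κ - 1`. If `σ(A)` is the zero element `∞`, reduce `A` to a sequence of
length less than `D` with sum `∞` and put terms back until the length is `D - 1`. This settles
nilsemigroups without identity, where every reducible sequence has sum `∞`. Otherwise `S` has an
identity; let `N` be the sequence of nonunits in `A`, and let `K` be the group of units that fix
`σ(N)`. It suffices to find `κ` units in `A` whose sum is in `K`. If `R` is a sequence of units that
is zero-sum free modulo `K`, then the union of `R` and `N` is irreducible
(`not_isReducible_map_add`), so `|R| ≤ D - 1 - |N|`. Since `κ` is at least the order of the quotient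
of the unit group by `K` and annihilates it, Gao's theorem (`exists_zero_sum_card_eq`) applies: over
a finite abelian group of order at most `k` that is annihilated by `k`, and whose zero-sum free
sequences have length at most `m`, every sequence of length at least `k + m` has a zero-sum
subsequence of length `k`. Gao's theorem rests on the existence of a zero-sum subsequence whose
length is at most the maximal multiplicity of a term (`exists_short_zero_sum`), which is a
consequence of Scherk's theorem on sumsets.
-/

namespace SemigroupZeroSum

/-! ### Submultisets -/

theorem exists_le_card_eq {α : Type*} {B A : Multiset α} {n : ℕ} (h : B ≤ A) (hB : B.card ≤ n)
    (hA : n ≤ A.card) : ∃ C, B ≤ C ∧ C ≤ A ∧ C.card = n := by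
  obtain ⟨D, rfl⟩ := Multiset.le_iff_exists_add.1 h
  obtain ⟨E, hE⟩ : ∃ E, E ∈ Multiset.powersetCard (n - B.card) D := by
    apply Multiset.exists_mem_of_ne_zero
    rw [← Multiset.card_pos, Multiset.card_powersetCard]
    rw [Multiset.card_add] at hA
    exact Nat.choose_pos (by omega)
  rw [Multiset.mem_powersetCard] at hE
  refine ⟨B + E, Multiset.le_add_right _ _, by gcongr; exact hE.1, ?_⟩
  rw [Multiset.card_add]
  omega

theorem exists_le_map_eq {α β : Type*} {f : α → β} {V : Multiset α} {T : Multiset β}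
    (h : T ≤ V.map f) : ∃ T' ≤ V, T'.map f = T := by
  have : T ∈ Multiset.powersetCard T.card (V.map f) := Multiset.mem_powersetCard.2 ⟨h, rfl⟩
  rw [Multiset.powersetCard_map, Multiset.mem_map] at this
  obtain ⟨T', hT', rfl⟩ := this
  exact ⟨T', (Multiset.mem_powersetCard.1 hT').1, rfl⟩

/-! ### Zero-sum subsequences of sequences over a finite abelian group -/

open scoped Pointwise in
/-- Scherk's theorem: if `0 ∈ A ∩ B` and `0 = a + b` with `a ∈ A`, `b ∈ B` only for `a = b = 0`,
then `|A| + |B| - 1 ≤ |A + B|`. A Dyson transform makes `B` smaller and preserves the hypotheses. -/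
theorem card_add_card_le_card_add_add_one {G : Type*} [AddCommGroup G] [DecidableEq G]
    (A B : Finset G) (hA : 0 ∈ A) (hB : 0 ∈ B)
    (h : ∀ a ∈ A, ∀ b ∈ B, a + b = 0 → b = 0) :
    A.card + B.card ≤ (A + B).card + 1 := by
  induction hn : B.card using Nat.strong_induction_on generalizing A B with
  | _ n ih =>
  subst hn
  by_cases hB1 : ∃ b ∈ B, b ≠ 0
  · obtain ⟨b, hb, hb0⟩ := hB1
    -- If `A + b ⊆ A`, then `A` contains every multiple of `b`, in particular `-b`.
    have hex : ∃ a ∈ A, a + b ∉ A := by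
      by_contra! hcl
      have himg : A.image (· + b) = A := by
        apply Finset.eq_of_subset_of_card_le
        · intro y hy
          obtain ⟨a, ha, rfl⟩ := Finset.mem_image.1 hy
          exact hcl a ha
        · rw [Finset.card_image_of_injective _ (add_left_injective b)]
      have h0 := hA
      rw [← himg] at h0
      obtain ⟨a, ha, hab⟩ := Finset.mem_image.1 h0
      exact hb0 (h a ha b hb hab)
    obtain ⟨a, ha, hab⟩ := hex
    have hcard := Finset.addDysonETransform.card a (A, B)
    have hsub := Finset.addDysonETransform.subset a (A, B)
    simp only [Finset.addDysonETransform] at hcard hsub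
    have hmem1 : ∀ x, x ∈ a +ᵥ B ↔ x - a ∈ B := fun x => by
      rw [Finset.mem_vadd_finset]
      constructor
      · rintro ⟨y, hy, rfl⟩
        simpa using hy
      · intro hx
        exact ⟨x - a, hx, by simp⟩
    have hmem2 : ∀ x, x ∈ (-a) +ᵥ A ↔ a + x ∈ A := fun x => by
      rw [Finset.mem_vadd_finset]
      constructor
      · rintro ⟨y, hy, rfl⟩
        simpa using hy
      · intro hx
        exact ⟨a + x, hx, by simp⟩
    have hlt : (B ∩ (-a +ᵥ A)).card < B.card := by
      apply Finset.card_lt_card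
      refine ⟨Finset.inter_subset_left, fun hss => hab ?_⟩
      exact (hmem2 b).1 (Finset.mem_inter.1 (hss hb)).2
    have key := ih _ hlt (A ∪ (a +ᵥ B)) (B ∩ (-a +ᵥ A)) (Finset.mem_union_left _ hA)
      (Finset.mem_inter.2 ⟨hB, (hmem2 0).2 (by simpa using ha)⟩) ?_ rfl
    · have := Finset.card_le_card hsub
      omega
    · intro x hx y hy hxy
      obtain ⟨hyB, hyA⟩ := Finset.mem_inter.1 hy
      rcases Finset.mem_union.1 hx with hx | hx
      · exact h x hx y hyB hxy
      · have hx' := (hmem1 x).1 hx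
        have hy' := (hmem2 y).1 hyA
        have hxa : x - a = 0 := h _ hy' _ hx' (by rw [← hxy]; abel)
        rw [sub_eq_zero] at hxa
        exact h x (hxa ▸ ha) y hyB hxy
  · push Not at hB1
    have : B.card ≤ 1 := Finset.card_le_one.2 fun x hx y hy => by rw [hB1 x hx, hB1 y hy]
    have h2 : A.card ≤ (A + B).card := Finset.card_le_card fun x hx =>
      Finset.mem_add.2 ⟨x, hx, 0, hB, add_zero x⟩
    omega

open scoped Pointwise in
/-- The terms of multiplicity more than `i` form sets `A 0, …, A (h - 1)` whose cardinalities add up to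
`|S|`. Without a zero-sum subsequence of length at most `h`, Scherk's theorem would give more than
`|S|` elements of `G` in the sum of the sets `A i ∪ {0}`. -/
theorem exists_short_zero_sum {G : Type*} [AddCommGroup G] [Fintype G] [DecidableEq G]
    (S : Multiset G) (h : ℕ) (hh : ∀ x, S.count x ≤ h) (hS : Fintype.card G ≤ S.card) :
    ∃ R ≤ S, R ≠ 0 ∧ R.card ≤ h ∧ R.sum = 0 := by
  by_contra! hno
  let A : ℕ → Finset G := fun i => S.toFinset.filter fun x => i < S.count x
  have hA0 : ∀ i, 0 ∉ A i := by
    intro i hi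
    obtain ⟨h0, hi⟩ := Finset.mem_filter.1 hi
    exact hno {0} (Multiset.singleton_le.2 (Multiset.mem_toFinset.1 h0)) (by simp)
      (by have := hh 0; simp; omega) (by simp)
  have key : ∀ n ≤ h, ∃ X : Finset G, 0 ∈ X ∧
      (∀ s ∈ X, ∃ R ≤ S, (∀ x, R.count x ≤ n) ∧ R.card ≤ n ∧ R.sum = s) ∧
      1 + ∑ i ∈ Finset.range n, (A i).card ≤ X.card := by
    intro n
    induction n with
    | zero =>
      intro _
      refine ⟨{0}, by simp, ?_, by simp⟩
      intro s hs
      exact ⟨0, by simp, by simp, by simp, by simpa using (Finset.mem_singleton.1 hs).symm⟩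
    | succ n ih =>
      intro hn
      obtain ⟨X, hX0, hX, hXc⟩ := ih (by omega)
      have hcons : ∀ a ∈ A n, ∀ R ≤ S, (∀ x, R.count x ≤ n) → a ::ₘ R ≤ S := by
        intro a ha R hR hRn
        rw [Multiset.le_iff_count] at hR ⊢
        intro x
        rw [Multiset.count_cons]
        split_ifs with hx
        · subst hx
          have := hRn x
          have := (Finset.mem_filter.1 ha).2
          omega
        · simpa using hR x
      refine ⟨X + insert 0 (A n), Finset.mem_add.2 ⟨0, hX0, 0, by simp, by simp⟩, ?_, ?_⟩
      · intro s hs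
        obtain ⟨t, ht, a, ha, rfl⟩ := Finset.mem_add.1 hs
        obtain ⟨R, hR, hRn, hRc, rfl⟩ := hX t ht
        rcases Finset.mem_insert.1 ha with rfl | ha
        · exact ⟨R, hR, fun x => (hRn x).trans (by omega), by omega, by simp⟩
        · refine ⟨a ::ₘ R, hcons a ha R hR hRn, ?_, by simp; omega, by simp [add_comm]⟩
          intro x
          rw [Multiset.count_cons]
          have := hRn x
          split_ifs <;> omega
      · have := card_add_card_le_card_add_add_one X (insert 0 (A n)) hX0 (by simp) ?_
        · rw [Finset.card_insert_of_notMem (hA0 n)] at this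
          rw [Finset.sum_range_succ]
          omega
        · intro t ht a ha hta
          rcases Finset.mem_insert.1 ha with rfl | ha
          · rfl
          · obtain ⟨R, hR, hRn, hRc, rfl⟩ := hX t ht
            exact absurd (by simpa [add_comm] using hta) (hno (a ::ₘ R) (hcons a ha R hR hRn)
              (by simp) (by simp; omega))
  obtain ⟨X, -, -, hXc⟩ := key h le_rfl
  have hsum : ∑ i ∈ Finset.range h, (A i).card = S.card := by
    simp only [A, Finset.card_filter]
    rw [Finset.sum_comm, ← Multiset.toFinset_sum_count_eq]
    refine Finset.sum_congr rfl fun x _ => ?_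
    rw [← Finset.card_filter]
    have : (Finset.range h).filter (fun i => i < S.count x) = Finset.range (S.count x) := by
      ext i
      have := hh x
      simp only [Finset.mem_filter, Finset.mem_range]
      omega
    rw [this, Finset.card_range]
  have := X.card_le_univ
  omega

/-- No nonempty subsequence of `R` has sum `0`. -/
def IsZeroSumFree {G : Type*} [AddCommMonoid G] (R : Multiset G) : Prop :=
  ∀ T ≤ R, T.sum = 0 → T = 0

theorem exists_zeroSumFree_add_eq {G : Type*} [AddCommGroup G] (T : Multiset G) :
    ∃ R C : Multiset G, R + C = T ∧ IsZeroSumFree R ∧ C.sum = 0 := by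
  induction hn : T.card using Nat.strong_induction_on generalizing T with
  | _ n ih =>
  by_cases hT : IsZeroSumFree T
  · exact ⟨T, 0, by simp, hT, by simp⟩
  · unfold IsZeroSumFree at hT
    push Not at hT
    obtain ⟨Z, hZ, hZ0, hZne⟩ := hT
    obtain ⟨T', rfl⟩ := Multiset.le_iff_exists_add.1 hZ
    have := Multiset.card_pos.2 hZne
    obtain ⟨R, C, rfl, hR, hC⟩ := ih T'.card (by simp at hn; omega) T' rfl
    exact ⟨R, Z + C, by abel, hR, by simp [hZ0, hC]⟩

/-- A zero-sum sequence that is longer than `k ≥ |G|` can be shortened by steps of at most `h`, so its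
length can be brought into the interval `[k - h, k]`. -/
theorem exists_zero_sum_card_mem_Icc {G : Type*} [AddCommGroup G] [Fintype G] [DecidableEq G]
    (k h : ℕ) (hk : Fintype.card G ≤ k) (C : Multiset G) (hC : C.sum = 0)
    (hh : ∀ x, C.count x ≤ h) (hkC : k ≤ C.card + h) :
    ∃ T ≤ C, T.sum = 0 ∧ T.card ≤ k ∧ k ≤ T.card + h := by
  induction hn : C.card using Nat.strong_induction_on generalizing C with
  | _ n ih =>
  by_cases hc : C.card ≤ k
  · exact ⟨C, le_rfl, hC, hc, hkC⟩
  · obtain ⟨R, hR, hR0, hRh, hRs⟩ := exists_short_zero_sum C h hh (by omega)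
    obtain ⟨C', rfl⟩ := Multiset.le_iff_exists_add.1 hR
    have := Multiset.card_pos.2 hR0
    simp only [Multiset.card_add, Multiset.sum_add, hRs, zero_add] at *
    obtain ⟨T, hT, h1⟩ := ih C'.card (by omega) C' hC
      (fun x => by have := hh x; rw [Multiset.count_add] at this; omega) (by omega) rfl
    exact ⟨T, hT.trans (Multiset.le_add_left _ _), h1⟩

/-- Gao's theorem, with the Davenport constant of `G` replaced by any bound `m` for the lengths of the
zero-sum free sequences, and `|G|` by any `k ≥ |G|` that annihilates `G`. -/
theorem exists_zero_sum_card_eq {G : Type*} [AddCommGroup G] [Fintype G] (k m : ℕ)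
    (hk : Fintype.card G ≤ k) (hkG : ∀ g : G, k • g = 0)
    (hm : ∀ R : Multiset G, IsZeroSumFree R → R.card ≤ m)
    (W : Multiset G) (hW : k + m ≤ W.card) :
    ∃ T ≤ W, T.card = k ∧ T.sum = 0 := by
  classical
  obtain ⟨g, hg⟩ := Finite.exists_max fun x : G => W.count x
  -- Translating by `-g` makes `0` a term of maximal multiplicity; it preserves zero-sum
  -- subsequences of length `k`, as `k • g = 0`.
  suffices H : ∃ T ≤ W.map (· - g), T.card = k ∧ T.sum = 0 by
    obtain ⟨T, hT, hTk, hT0⟩ := H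
    refine ⟨T.map (· + g), ?_, by simpa using hTk, ?_⟩
    · have := Multiset.map_le_map (f := (· + g)) hT
      simpa using this
    · simp [Multiset.sum_map_add, hT0, hTk, hkG]
  have hcount : ∀ x, (W.map (· - g)).count x = W.count (x + g) := by
    intro x
    have := Multiset.count_map_eq_count' (· - g) W (sub_left_injective) (x + g)
    simpa using this
  obtain ⟨h, hh⟩ : ∃ h, h = W.count g := ⟨_, rfl⟩
  set V := W.map (· - g) with hV
  have hVcard : V.card = W.card := by simp [hV]
  have hV0 : V.count 0 = h := by rw [hcount, zero_add, hh]
  have hVle : ∀ x, V.count x ≤ h := fun x => by rw [hcount, hh]; exact hg _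
  have hsplit : Multiset.replicate h 0 + V.filter (fun x => ¬ x = 0) = V := by
    rw [← hV0, ← Multiset.filter_eq']
    exact Multiset.filter_add_not _ V
  -- `V` consists of `h` zeros and at least `k + m - h` nonzero terms, of which all but at most `m`
  -- form a zero-sum sequence `C`. Shorten `C` to a length in `[k - h, k]` and fill up with zeros.
  obtain ⟨R, C, hRC, hR, hC⟩ := exists_zeroSumFree_add_eq (V.filter fun x => ¬ x = 0)
  have hRm := hm R hR
  rw [← hRC] at hsplit
  have hcard := congrArg Multiset.card hsplit
  simp only [Multiset.card_add, Multiset.card_replicate] at hcard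
  have hCV : C ≤ V := by
    rw [← hsplit, ← add_assoc]
    exact Multiset.le_add_left _ _
  obtain ⟨T, hT, hT0, hTk, hkT⟩ := exists_zero_sum_card_mem_Icc k h hk C hC
    (fun x => (Multiset.count_le_of_le x hCV).trans (hVle x)) (by omega)
  refine ⟨Multiset.replicate (k - T.card) 0 + T, ?_, by simp; omega, by simp [hT0]⟩
  rw [← hsplit]
  gcongr
  · omega
  · exact hT.trans (Multiset.le_add_left _ _)

/-! ### Subdirectly irreducible finite commutative semigroups -/

section Structure

variable {S : Type u} [AddCommSemigroup S]

/-- The congruence that identifies `x` and `y` when `e + x = e + y`. -/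
def translationCon (e : S) : AddCon S where
  r x y := e + x = e + y
  iseqv := ⟨fun _ => rfl, Eq.symm, Eq.trans⟩
  add' {w x y z} h₁ h₂ := by
    rw [← add_assoc, h₁, add_assoc, add_left_comm, h₂, add_left_comm]

/-- For an idempotent `e` this is the Rees congruence of the ideal `e + S`, which collapses `e + S`
to a point: since `e` is idempotent, `x ∈ e + S` means `e + x = x`. -/
def reesCon (e : S) : AddCon S where
  r x y := x = y ∨ e + x = x ∧ e + y = y
  iseqv := by
    refine ⟨fun _ => Or.inl rfl, ?_, ?_⟩
    · rintro x y (rfl | ⟨h₁, h₂⟩)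
      · exact Or.inl rfl
      · exact Or.inr ⟨h₂, h₁⟩
    · rintro x y z (rfl | ⟨h₁, h₂⟩) (rfl | ⟨h₃, h₄⟩)
      · exact Or.inl rfl
      · exact Or.inr ⟨h₃, h₄⟩
      · exact Or.inr ⟨h₁, h₂⟩
      · exact Or.inr ⟨h₁, h₄⟩
  add' {w x y z} h₁ h₂ := by
    rcases h₁ with rfl | ⟨h₁, h₁'⟩
    · rcases h₂ with rfl | ⟨h₂, h₂'⟩
      · exact Or.inl rfl
      · exact Or.inr ⟨by rw [add_left_comm, h₂], by rw [add_left_comm, h₂']⟩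
    · exact Or.inr ⟨by rw [← add_assoc, h₁], by rw [← add_assoc, h₁']⟩

/-- Two congruences that meet in equality make `S` a subdirect product of the two quotients, so one of
them is equality. -/
theorem IsSubdirectlyIrreducible.eq_bot_or_eq_bot (hS : IsSubdirectlyIrreducible S)
    (c d : AddCon S) (h : ∀ x y, c x y → d x y → x = y) :
    (∀ x y, c x y → x = y) ∨ (∀ x y, d x y → x = y) := by
  let F : ULift.{u} Bool → AddCon S := fun i => if i.down then c else d
  obtain ⟨⟨b⟩, hb⟩ := hS (ULift.{u} Bool) (fun i => (F i).Quotient)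
    (fun i => { toFun := fun x => (x : (F i).Quotient), map_add' := fun _ _ => rfl })
    (fun i => Quotient.mk_surjective)
    (fun x y hxy => h x y ((AddCon.eq _).1 (hxy ⟨true⟩)) ((AddCon.eq _).1 (hxy ⟨false⟩)))
  cases b
  · exact Or.inr fun x y hxy => hb.1 ((AddCon.eq d).2 hxy)
  · exact Or.inl fun x y hxy => hb.1 ((AddCon.eq c).2 hxy)

/-- On `e + S` the translation by `e` is the identity, so the translation congruence and the Rees
congruence of `e` meet in equality. -/
theorem IsSubdirectlyIrreducible.isIdentityElt_or_isZeroElt (hS : IsSubdirectlyIrreducible S)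
    (e : S) (he : e + e = e) : IsIdentityElt e ∨ IsZeroElt e := by
  have hmeet : ∀ x y : S, translationCon e x y → reesCon e x y → x = y := by
    rintro x y hxy (rfl | ⟨h₁, h₂⟩)
    · rfl
    · rw [← h₁, ← h₂]
      exact hxy
  rcases hS.eq_bot_or_eq_bot _ _ hmeet with h | h
  · exact Or.inl fun a => h _ _ (show e + (e + a) = e + a by rw [← add_assoc, he])
  · exact Or.inr fun a => h _ _ (Or.inr ⟨by rw [← add_assoc, he], he⟩)

/-- `S` carries no action of `ℕ`, so multiples of `x` are formed in `WithZero S`. -/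
theorem exists_coe_eq_nsmul (x : S) (n : ℕ) (hn : 0 < n) :
    ∃ y : S, n • (x : WithZero S) = (y : WithZero S) := by
  induction n, hn using Nat.le_induction with
  | base => exact ⟨x, one_nsmul _⟩
  | succ n _ ih =>
    obtain ⟨y, hy⟩ := ih
    exact ⟨y + x, by rw [succ_nsmul, hy, WithZero.coe_add]⟩

theorem exists_nsmul_eq_add_nsmul [Finite S] (x : S) :
    ∃ t, 0 < t ∧ ∃ r, 0 < r ∧ r • (x : WithZero S) = (r + t) • (x : WithZero S) := by
  have : Finite (WithZero S) := inferInstanceAs (Finite (Option S))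
  obtain ⟨i, j, hij, h⟩ := Finite.exists_ne_map_eq_of_infinite
    fun n : ℕ => (n + 1) • (x : WithZero S)
  wlog hlt : i < j generalizing i j
  · exact this j i hij.symm h.symm (by omega)
  exact ⟨j - i, by omega, i + 1, by omega, by rw [h]; congr 1; omega⟩

theorem exists_nsmul_eq_idempotent [Finite S] (x : S) :
    ∃ n, 0 < n ∧ ∃ e : S, e + e = e ∧ n • (x : WithZero S) = (e : WithZero S) := by
  obtain ⟨t, ht, r, hr, h⟩ := exists_nsmul_eq_add_nsmul x
  -- Periodicity propagates from `r` to `r + j` and to every multiple of the period `t`.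
  have h1 : ∀ k j, (r + j) • (x : WithZero S) = (r + j + k * t) • (x : WithZero S) := by
    intro k j
    induction k with
    | zero => simp
    | succ k ih =>
      rw [ih, show r + j + (k + 1) * t = (r + t) + (j + k * t) by ring,
        add_nsmul (x : WithZero S) (r + t), ← h, ← add_nsmul, add_assoc]
  obtain ⟨e, he⟩ := exists_coe_eq_nsmul x (r * t) (by positivity)
  refine ⟨r * t, by positivity, e, ?_, he⟩
  apply WithZero.coe_injective
  obtain ⟨j, hj⟩ := Nat.exists_eq_add_of_le (Nat.le_mul_of_pos_right r ht)
  rw [WithZero.coe_add, ← he, ← add_nsmul, hj, h1 r j, ← hj]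

theorem IsSubdirectlyIrreducible.exists_nsmul_eq [Finite S] (hS : IsSubdirectlyIrreducible S)
    (x : S) : ∃ n, 0 < n ∧ ∃ e : S, (IsIdentityElt e ∨ IsZeroElt e) ∧
      n • (x : WithZero S) = (e : WithZero S) := by
  obtain ⟨n, hn, e, he, h⟩ := exists_nsmul_eq_idempotent x
  exact ⟨n, hn, e, hS.isIdentityElt_or_isZeroElt e he, h⟩

theorem IsIdentityElt.eq {e f : S} (he : IsIdentityElt e) (hf : IsIdentityElt f) : e = f := by
  rw [← hf e, add_comm, he]

theorem IsZeroElt.eq {z w : S} (hz : IsZeroElt z) (hw : IsZeroElt w) : z = w := by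
  rw [← hz w, add_comm, hw]

theorem nsmul_coe_self {e : S} (he : e + e = e) {n : ℕ} (hn : 0 < n) :
    n • (e : WithZero S) = (e : WithZero S) := by
  induction n, hn using Nat.le_induction with
  | base => exact one_nsmul _
  | succ n _ ih => rw [succ_nsmul, ih, ← WithZero.coe_add, he]

theorem IsSubdirectlyIrreducible.classification [Finite S] [Nonempty S]
    (hS : IsSubdirectlyIrreducible S) :
    IsNilsemigroup S ∨ IsAbelianGroup S ∨ IsElementary S := by
  by_cases hid : ∃ e : S, IsIdentityElt e
  swap
  · left
    have key : ∀ x : S, ∃ n, 0 < n ∧ ∃ z : S, IsZeroElt z ∧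
        n • (x : WithZero S) = (z : WithZero S) := by
      intro x
      obtain ⟨n, hn, e, he | he, h⟩ := hS.exists_nsmul_eq x
      · exact absurd ⟨e, he⟩ hid
      · exact ⟨n, hn, e, he, h⟩
    obtain ⟨-, -, z, hz, -⟩ := key (Classical.arbitrary S)
    refine ⟨z, hz, fun x => ?_⟩
    obtain ⟨n, hn, w, hw, h⟩ := key x
    exact ⟨n, hn, by rw [h, hw.eq hz]⟩
  obtain ⟨e, he⟩ := hid
  have hinv : ∀ x : S, ∀ n, 0 < n → n • (x : WithZero S) = (e : WithZero S) →
      ∃ y : S, (∃ m, 0 < m ∧ m • (y : WithZero S) = (e : WithZero S)) ∧ x + y = e := by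
    intro x n hn h
    -- `2n - 1` instead of `n - 1`, which may be `0`.
    obtain ⟨y, hy⟩ := exists_coe_eq_nsmul x (2 * n - 1) (by omega)
    refine ⟨y, ⟨n, hn, ?_⟩, ?_⟩
    · rw [← hy, ← mul_nsmul', mul_comm, mul_nsmul', h, nsmul_coe_self (he e) (by omega)]
    · apply WithZero.coe_injective
      rw [WithZero.coe_add, ← hy, ← succ_nsmul', show 2 * n - 1 + 1 = n * 2 by omega, mul_nsmul, h,
        nsmul_coe_self (he e) (by omega)]
  by_cases hze : ∃ z : S, IsZeroElt z ∧ z ≠ e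
  · obtain ⟨z, hz, hne⟩ := hze
    refine Or.inr (Or.inr ⟨{x | ∃ n, 0 < n ∧ n • (x : WithZero S) = (e : WithZero S)},
      {x | ∃ n, 0 < n ∧ n • (x : WithZero S) = (z : WithZero S)}, ?_, ?_, ?_, ?_, ?_, ?_⟩)
    · rw [Set.disjoint_left]
      rintro x ⟨n, hn, hx⟩ ⟨m, hm, hx'⟩
      apply hne
      apply WithZero.coe_injective
      rw [← nsmul_coe_self (hz z) hn, ← hx', ← mul_nsmul, mul_nsmul', hx,
        nsmul_coe_self (he e) hm]
    · rw [Set.eq_univ_iff_forall]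
      intro x
      obtain ⟨n, hn, f, hf | hf, h⟩ := hS.exists_nsmul_eq x
      · exact Or.inl ⟨n, hn, by rw [h, hf.eq he]⟩
      · exact Or.inr ⟨n, hn, by rw [h, hf.eq hz]⟩
    · rintro a ⟨n, hn, ha⟩ b ⟨m, hm, hb⟩
      refine ⟨n * m, by positivity, ?_⟩
      rw [WithZero.coe_add, nsmul_add, mul_nsmul, mul_nsmul', ha, hb,
        nsmul_coe_self (he e) hn, nsmul_coe_self (he e) hm, ← WithZero.coe_add, he]
    · refine ⟨e, ⟨1, one_pos, one_nsmul _⟩, he, ?_⟩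
      rintro a ⟨n, hn, ha⟩
      exact hinv a n hn ha
    · rintro a ⟨n, hn, ha⟩ s
      obtain ⟨t, ht⟩ := exists_coe_eq_nsmul s n hn
      refine ⟨n, hn, ?_⟩
      rw [WithZero.coe_add, nsmul_add, ha, ht, ← WithZero.coe_add, hz]
    · exact ⟨z, ⟨1, one_pos, one_nsmul _⟩, hz, fun x hx => hx⟩
  · push Not at hze
    -- Here a zero element, if there is one, is the identity (and `S` is trivial).
    refine Or.inr (Or.inl ⟨e, he, fun a => ?_⟩)
    obtain ⟨n, hn, f, hf, h⟩ := hS.exists_nsmul_eq a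
    obtain rfl : f = e := hf.elim (fun hf => hf.eq he) (hze f)
    obtain ⟨y, -, hy⟩ := hinv a n hn h
    exact ⟨y, hy⟩

end Structure

/-! ### Invariants of a finite commutative semigroup -/

section Semigroup

variable {S : Type u} [AddCommSemigroup S]

theorem period_pos [Finite S] (a : S) : 0 < period a :=
  (Nat.sInf_mem (exists_nsmul_eq_add_nsmul a)).1

theorem exists_nsmul_eq_add_period_nsmul [Finite S] (a : S) :
    ∃ r, 0 < r ∧ r • (a : WithZero S) = (r + period a) • (a : WithZero S) :=
  (Nat.sInf_mem (exists_nsmul_eq_add_nsmul a)).2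

variable (S) in
theorem semigroupExp_pos [Fintype S] : 0 < semigroupExp S := by
  rw [semigroupExp, Nat.pos_iff_ne_zero, Ne, Finset.lcm_eq_zero_iff]
  rintro ⟨a, -, ha⟩
  exact (period_pos a).ne' ha

theorem period_dvd_kappa [Fintype S] (a : S) : period a ∣ kappa S :=
  (Finset.dvd_lcm (Finset.mem_univ a)).mul_left _

variable (S) in
theorem card_le_kappa [Fintype S] : Fintype.card S ≤ kappa S := by
  have h := semigroupExp_pos S
  have h1 := Nat.le_ceil ((Fintype.card S : ℚ) / (semigroupExp S : ℚ))
  rw [div_le_iff₀ (by exact_mod_cast h)] at h1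
  exact_mod_cast h1

variable (S) in
theorem kappa_pos [Fintype S] [Nonempty S] : 0 < kappa S :=
  Fintype.card_pos.trans_le (card_le_kappa S)

theorem sigma_eq_of_not_exists_identity (hS : ¬ ∃ e : S, IsIdentityElt e) (A : Multiset S) :
    sigma A = (A.map fun a : S => (a : WithZero S)).sum := by
  rw [sigma, dif_neg fun h => hS h.2]

theorem exists_le_card_lt_sigma_eq {d : ℕ} (hd : ∀ A : Multiset S, d ≤ A.card → IsReducible A)
    (A : Multiset S) : ∃ B ≤ A, B.card < d ∧ sigma B = sigma A := by
  induction hn : A.card using Nat.strong_induction_on generalizing A with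
  | _ n ih =>
  by_cases hA : A.card < d
  · exact ⟨A, le_rfl, hA, rfl⟩
  · obtain ⟨B, hBA, hB⟩ := hd A (by omega)
    obtain ⟨C, hC, hCd, hCs⟩ := ih _ (hn ▸ Multiset.card_lt_card hBA) B rfl
    exact ⟨C, hC.trans hBA.le, hCd, hCs.trans hB⟩

/-- The property that defines `gaoConstant`, for `k = kappa S`: every sequence of length `ℓ` has a
subsequence with the same sum, obtained by deleting exactly `k` terms. -/
def HasDeletion (S : Type u) [AddCommSemigroup S] (k ℓ : ℕ) : Prop :=
  ∀ A : Multiset S, A.card = ℓ → ∃ B ≤ A, sigma B = sigma A ∧ B.card + k = A.card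

theorem gaoConstant_le [Fintype S] [Nonempty S]
    (h : ∀ d, 0 < d → (∀ A : Multiset S, d ≤ A.card → IsReducible A) →
      HasDeletion S (kappa S) (d + kappa S - 1)) :
    gaoConstant S ≤ davenport S + (kappa S : ℕ∞) - 1 := by
  have hk := kappa_pos S
  rcases Set.eq_empty_or_nonempty
    {ℓ : ℕ | 0 < ℓ ∧ ∀ A : Multiset S, ℓ ≤ A.card → IsReducible A} with he | hne
  · rw [davenport, he]
    simp
  · obtain ⟨d, ⟨hd0, hd⟩, hdD⟩ := csInf_mem (hne.image fun ℓ : ℕ => (ℓ : ℕ∞))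
    rw [davenport, ← hdD, gaoConstant]
    refine sInf_le ⟨d + kappa S - 1, ⟨by omega, h d hd0 hd⟩, ?_⟩
    push_cast
    rfl

/-- A sequence of length at least `d` is reducible, and a reducible sequence has sum `∞`. Reduce it to
less than `d` terms and put terms back until there are `d - 1`; the sum remains `∞`. -/
theorem hasDeletion_of_isNilsemigroup [Fintype S] [Nonempty S] (hid : ¬ ∃ e : S, IsIdentityElt e)
    (hS : IsNilsemigroup S) {d : ℕ} (hd0 : 0 < d)
    (hd : ∀ A : Multiset S, d ≤ A.card → IsReducible A) :
    HasDeletion S (kappa S) (d + kappa S - 1) := by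
  obtain ⟨z, hz, hnil⟩ := hS
  have hk := kappa_pos S
  intro A hA
  have hcoe : ∀ C : Multiset S, C ≠ 0 →
      ∃ c : S, (C.map fun a : S => (a : WithZero S)).sum = (c : WithZero S) := by
    intro C
    induction C using Multiset.induction with
    | empty => simp
    | cons a C ih =>
      intro _
      by_cases hC : C = 0
      · exact ⟨a, by simp [hC]⟩
      · obtain ⟨c, hc⟩ := ih hC
        exact ⟨a + c, by rw [Multiset.map_cons, Multiset.sum_cons, hc, WithZero.coe_add]⟩
  -- If `σ(B) = σ(B) + σ(C)`, then `σ(B) = σ(B) + nσ(C) = ∞`.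
  have hAz : sigma A = (z : WithZero S) := by
    obtain ⟨B, hBA, hB⟩ := hd A (by omega)
    obtain ⟨C, rfl⟩ := Multiset.le_iff_exists_add.1 hBA.le
    have hC : C ≠ 0 := by
      rintro rfl
      simp at hBA
    obtain ⟨c, hc⟩ := hcoe C hC
    obtain ⟨n, hn, hcn⟩ := hnil c
    rw [← hB]
    simp only [sigma_eq_of_not_exists_identity hid, Multiset.map_add, Multiset.sum_add] at hB ⊢
    have hB0 : B ≠ 0 := by
      rintro rfl
      rw [hc] at hB
      simp at hB
    obtain ⟨b, hb⟩ := hcoe B hB0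
    rw [hb, hc] at hB
    have hiter : ∀ n : ℕ, (b : WithZero S) = b + n • (c : WithZero S) := by
      intro n
      induction n with
      | zero => simp
      | succ n ih => rw [succ_nsmul, ← add_assoc, ← ih, ← hB]
    rw [hb, hiter n, hcn, ← WithZero.coe_add, add_comm, hz]
  obtain ⟨B, hBA, hBd, hB⟩ := exists_le_card_lt_sigma_eq hd A
  obtain ⟨C, hBC, hCA, hC⟩ := exists_le_card_eq (n := d - 1) hBA (by omega) (by omega)
  refine ⟨C, hCA, ?_, by omega⟩
  obtain ⟨E, rfl⟩ := Multiset.le_iff_exists_add.1 hBC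
  rw [hAz] at hB ⊢
  by_cases hE : E = 0
  · rw [hE, add_zero, hB]
  · obtain ⟨c, hc⟩ := hcoe E hE
    rw [sigma_eq_of_not_exists_identity hid] at hB ⊢
    rw [Multiset.map_add, Multiset.sum_add, hB, hc, ← WithZero.coe_add, hz]

end Semigroup

/-! ### Semigroups with an identity element -/

section Monoid

variable {M : Type u} [AddCommMonoid M]

theorem isIdentityElt_iff {e : M} : IsIdentityElt e ↔ e = 0 :=
  ⟨fun h => by rw [← h 0, add_zero], fun h a => by rw [h, zero_add]⟩

theorem nsmul_coe (x : M) {n : ℕ} (hn : 0 < n) :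
    n • (x : WithZero M) = ((n • x : M) : WithZero M) := by
  induction n, hn using Nat.le_induction with
  | base => rw [one_nsmul, one_nsmul]
  | succ n _ ih => rw [succ_nsmul, succ_nsmul, ih, WithZero.coe_add]

theorem sigma_eq_coe_sum (A : Multiset M) : sigma A = ((A.sum : M) : WithZero M) := by
  by_cases hA : A = 0
  · have h : A = 0 ∧ ∃ e : M, IsIdentityElt e := ⟨hA, 0, isIdentityElt_iff.2 rfl⟩
    rw [sigma, dif_pos h, isIdentityElt_iff.1 h.2.choose_spec, hA, Multiset.sum_zero]
  · rw [sigma, dif_neg fun h => hA h.1]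
    induction A using Multiset.induction with
    | empty => exact absurd rfl hA
    | cons a A ih =>
      by_cases h : A = 0
      · simp [h]
      · rw [Multiset.map_cons, Multiset.sum_cons, Multiset.sum_cons, ih h, WithZero.coe_add]

theorem sigma_eq_sigma_iff {A B : Multiset M} : sigma A = sigma B ↔ A.sum = B.sum := by
  rw [sigma_eq_coe_sum, sigma_eq_coe_sum, WithZero.coe_inj]

theorem kappa_nsmul_addUnits [Fintype M] (g : AddUnits M) : kappa M • g = 0 := by
  obtain ⟨r, hr, h⟩ := exists_nsmul_eq_add_period_nsmul (g : M)
  rw [nsmul_coe _ hr, nsmul_coe _ (by omega), WithZero.coe_inj, ← AddUnits.val_nsmul_eq_nsmul_val,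
    ← AddUnits.val_nsmul_eq_nsmul_val] at h
  have h' := AddUnits.ext h
  rw [add_nsmul, left_eq_add] at h'
  obtain ⟨q, hq⟩ := period_dvd_kappa (g : M)
  rw [hq, mul_nsmul, h', nsmul_zero]

/-- Append `κ - 1` copies of `0` to an irreducible sequence: a deletion of `κ` terms would delete a
term of the irreducible sequence. -/
theorem davenport_add_kappa_sub_one_le [Fintype M] :
    davenport M + (kappa M : ℕ∞) - 1 ≤ gaoConstant M := by
  classical
  have hk := kappa_pos M
  refine le_sInf ?_
  rintro _ ⟨ℓ, ⟨hℓ0, hℓ⟩, rfl⟩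
  have hkℓ : kappa M ≤ ℓ := by
    obtain ⟨B, -, -, hB⟩ := hℓ (Multiset.replicate ℓ 0) (by simp)
    simp at hB
    omega
  have hD : davenport M ≤ ((ℓ - kappa M + 1 : ℕ) : ℕ∞) := by
    refine sInf_le ⟨_, ⟨by omega, fun A hA => ?_⟩, rfl⟩
    obtain ⟨A', -, hA', hcard⟩ := exists_le_card_eq (Multiset.zero_le A) (by simp) hA
    obtain ⟨A'', rfl⟩ := Multiset.le_iff_exists_add.1 hA'
    obtain ⟨B, hB, hBs, hBc⟩ := hℓ (A' + Multiset.replicate (kappa M - 1) 0)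
      (by simp; omega)
    simp only [Multiset.card_add, Multiset.card_replicate] at hBc
    rw [sigma_eq_sigma_iff] at hBs
    have hle : B.filter (fun x => ¬ x = 0) ≤ A' := by
      have := Multiset.filter_le_filter (fun x => ¬ x = 0) hB
      rw [Multiset.filter_add, (Multiset.filter_eq_nil (s := Multiset.replicate _ _)).2
        fun a ha => not_not.2 (Multiset.eq_of_mem_replicate ha), add_zero] at this
      exact this.trans (Multiset.filter_le _ _)
    have hsum : (B.filter (fun x => ¬ x = 0)).sum = B.sum := by
      conv_rhs => rw [← Multiset.filter_add_not (fun x => x = 0) B, Multiset.sum_add,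
        Multiset.sum_eq_zero fun x hx => (Multiset.mem_filter.1 hx).2, zero_add]
    have hc := Multiset.card_le_card (Multiset.filter_le (fun x => ¬ x = 0) B)
    refine ⟨B.filter (fun x => ¬ x = 0) + A'', ?_, ?_⟩
    · refine add_lt_add_left (lt_of_le_of_ne hle fun h => ?_) _
      rw [h] at hc
      omega
    · rw [sigma_eq_sigma_iff, Multiset.sum_add, Multiset.sum_add, hsum, hBs]
      simp
  calc davenport M + (kappa M : ℕ∞) - 1
      ≤ ((ℓ - kappa M + 1 : ℕ) : ℕ∞) + (kappa M : ℕ∞) - 1 := by gcongr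
    _ = ((ℓ - kappa M + 1 + kappa M - 1 : ℕ) : ℕ∞) := by push_cast; rfl
    _ = (ℓ : ℕ∞) := by congr 1; omega

/-- The units `g` with `g + x = x`. -/
def unitStabilizer (x : M) : AddSubgroup (AddUnits M) where
  carrier := {g | (g : M) + x = x}
  zero_mem' := by simp
  add_mem' {a b} ha hb := by
    simp only [Set.mem_ofPred_eq, AddUnits.val_add] at *
    rw [add_assoc, hb, ha]
  neg_mem' {a} ha := by
    simp only [Set.mem_ofPred_eq] at *
    conv_lhs => rw [← ha, AddUnits.neg_add_cancel_left]

theorem mem_unitStabilizer {x : M} {g : AddUnits M} :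
    g ∈ unitStabilizer x ↔ (g : M) + x = x := Iff.rfl

theorem coe_addUnits_sum (V : Multiset (AddUnits M)) :
    ((V.sum : AddUnits M) : M) = (V.map AddUnits.val).sum :=
  map_multiset_sum (AddUnits.coeHom M) V

/-- `x` is a unit or some multiple of `x` is the zero element. If this holds for all `x`, then the
monoid is an abelian group or an elementary semigroup. -/
def IsUnitOrNil (x : M) : Prop :=
  IsAddUnit x ∨ ∃ z : M, IsZeroElt z ∧ ∃ n : ℕ, n • x = z

/-- Deleting nonunits would make the sum absorb a nilpotent element and hence be `∞`; deleting units
means that their sum fixes `N.sum`, against the zero-sum freeness of `R` modulo the stabilizer. -/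
theorem not_isReducible_map_add (hM : ∀ x : M, IsUnitOrNil x) (N : Multiset M)
    (hN : ∀ a ∈ N, ¬ IsAddUnit a) (hz : ¬ IsZeroElt N.sum) (R : Multiset (AddUnits M))
    (hR : IsZeroSumFree (R.map (QuotientAddGroup.mk : _ → AddUnits M ⧸ unitStabilizer N.sum))) :
    ¬ IsReducible (R.map AddUnits.val + N) := by
  classical
  rintro ⟨B, hB, hBs⟩
  obtain ⟨C, hBC⟩ := Multiset.le_iff_exists_add.1 hB.le
  have hC0 : C ≠ 0 := by
    rintro rfl
    rw [hBC, add_zero] at hB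
    exact lt_irrefl _ hB
  rw [sigma_eq_sigma_iff] at hBs
  have hBC' := congrArg Multiset.sum hBC
  rw [Multiset.sum_add B C, ← hBs] at hBC'
  by_cases hu : ∀ c ∈ C, IsAddUnit c
  · have hCR : C ≤ R.map AddUnits.val := by
      have h1 : C ≤ R.map AddUnits.val + N := hBC ▸ Multiset.le_add_left C B
      have h2 := Multiset.filter_le_filter IsAddUnit h1
      rw [Multiset.filter_eq_self.2 hu, Multiset.filter_add, Multiset.filter_eq_nil.2 hN,
        add_zero] at h2
      exact h2.trans (Multiset.filter_le _ _)
    obtain ⟨C, hCR', rfl⟩ := exists_le_map_eq hCR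
    rw [hBs, Multiset.sum_add, ← coe_addUnits_sum, ← coe_addUnits_sum, add_assoc,
      AddUnits.add_right_inj, add_comm] at hBC'
    have h3 := hR _ (Multiset.map_le_map hCR') (by
      rw [← QuotientAddGroup.coe_mk', ← map_multiset_sum, QuotientAddGroup.coe_mk',
        QuotientAddGroup.eq_zero_iff, mem_unitStabilizer]
      exact hBC'.symm)
    rw [Multiset.map_eq_zero] at h3
    simp [h3] at hC0
  · push Not at hu
    obtain ⟨c, hc, hcu⟩ := hu
    have hCu : ¬ IsAddUnit C.sum := by
      rw [← Multiset.cons_erase hc, Multiset.sum_cons]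
      exact fun h => hcu (isAddUnit_of_add_isAddUnit_left h)
    obtain ⟨z, hz', n, hn⟩ := (hM C.sum).resolve_left hCu
    have hiter : ∀ n : ℕ, B.sum = B.sum + n • C.sum := by
      intro n
      induction n with
      | zero => simp
      | succ n ih => rw [succ_nsmul, ← add_assoc, ← ih, ← hBC']
    have h4 := hiter n
    rw [hn, add_comm, hz', hBs, Multiset.sum_add, ← coe_addUnits_sum] at h4
    -- A unit added to `N.sum` gives the zero element only if `N.sum` is the zero element.
    have h5 : N.sum = z := by
      rw [← AddUnits.add_right_inj R.sum, h4, add_comm, hz']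
    exact hz (h5 ▸ hz')

/-- If `σ(A) ≠ ∞`, only units are deleted: their sum has to lie in the stabilizer of the sum of the
nonunits, which is a zero-sum problem in the quotient of the group of units by that stabilizer. -/
theorem hasDeletion_of_isUnitOrNil [Fintype M] (hM : ∀ x : M, IsUnitOrNil x) {d : ℕ}
    (hd0 : 0 < d) (hd : ∀ A : Multiset M, d ≤ A.card → IsReducible A) :
    HasDeletion M (kappa M) (d + kappa M - 1) := by
  classical
  have hk := kappa_pos M
  intro A hA
  by_cases hAz : IsZeroElt A.sum
  · obtain ⟨B, hBA, hBd, hB⟩ := exists_le_card_lt_sigma_eq hd A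
    obtain ⟨C, hBC, hCA, hC⟩ := exists_le_card_eq (n := d - 1) hBA (by omega) (by omega)
    refine ⟨C, hCA, ?_, by omega⟩
    obtain ⟨E, rfl⟩ := Multiset.le_iff_exists_add.1 hBC
    rw [sigma_eq_sigma_iff] at hB ⊢
    rw [Multiset.sum_add, hB, hAz]
  obtain ⟨V, hV⟩ : ∃ V : Multiset (AddUnits M), V.map AddUnits.val = A.filter IsAddUnit := by
    have h := Multiset.canLift (AddUnits.val : AddUnits M → M) IsAddUnit
    exact h.prf _ fun x hx => (Multiset.mem_filter.1 hx).2
  obtain ⟨N, hN⟩ : ∃ N, N = A.filter fun x => ¬ IsAddUnit x := ⟨_, rfl⟩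
  have hVN : V.map AddUnits.val + N = A := by
    rw [hV, hN]
    exact Multiset.filter_add_not _ A
  have hNu : ∀ a ∈ N, ¬ IsAddUnit a := fun a ha => by
    rw [hN] at ha
    exact (Multiset.mem_filter.1 ha).2
  have hNz : ¬ IsZeroElt N.sum := fun h => hAz <| by
    rw [← hVN, Multiset.sum_add, add_comm, h]
    exact h
  let H := AddUnits M ⧸ unitStabilizer N.sum
  have hmk : Function.Surjective (QuotientAddGroup.mk : AddUnits M → H) :=
    QuotientAddGroup.mk_surjective
  have : Finite (AddUnits M) := Finite.of_injective _ AddUnits.val_injective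
  have : Fintype H := Fintype.ofFinite H
  have hcardH : Fintype.card H ≤ kappa M := by
    refine le_trans ?_ (card_le_kappa M)
    rw [← Nat.card_eq_fintype_card, ← Nat.card_eq_fintype_card]
    exact (Nat.card_le_card_of_surjective _ hmk).trans
      (Nat.card_le_card_of_injective _ AddUnits.val_injective)
  have hfree : ∀ R : Multiset H, IsZeroSumFree R → R.card + N.card < d := by
    intro R hR
    obtain ⟨R, rfl⟩ := Multiset.map_surjective_of_surjective hmk R
    by_contra! h
    exact not_isReducible_map_add hM N hNu hNz R hR (hd _ (by simpa using h))
  have hNd : N.card < d := by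
    simpa using hfree 0 fun T hT _ => Multiset.le_zero.1 hT
  have hcard := congrArg Multiset.card hVN
  simp only [Multiset.card_add, Multiset.card_map] at hcard
  obtain ⟨T, hT, hTk, hT0⟩ := exists_zero_sum_card_eq (kappa M) (d - 1 - N.card) hcardH
    (fun g => by
      obtain ⟨g, rfl⟩ := hmk g
      rw [← QuotientAddGroup.mk_nsmul, kappa_nsmul_addUnits, QuotientAddGroup.mk_zero])
    (fun R hR => by have := hfree R hR; omega)
    (V.map (QuotientAddGroup.mk : AddUnits M → H)) (by simp; omega)
  obtain ⟨T, hTV, rfl⟩ := exists_le_map_eq hT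
  obtain ⟨V', rfl⟩ := Multiset.le_iff_exists_add.1 hTV
  have hTN : (T.sum : M) + N.sum = N.sum := by
    rw [← mem_unitStabilizer, ← QuotientAddGroup.eq_zero_iff]
    rw [← hT0]
    exact map_multiset_sum (QuotientAddGroup.mk' (unitStabilizer N.sum)) T
  have hA' : T.map AddUnits.val + (V'.map AddUnits.val + N) = A := by
    rw [← hVN, Multiset.map_add, add_assoc]
  refine ⟨V'.map AddUnits.val + N, ?_, ?_, ?_⟩
  · rw [← hA']
    exact Multiset.le_add_left _ _
  · rw [sigma_eq_sigma_iff, ← hA', Multiset.sum_add, Multiset.sum_add, Multiset.sum_add,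
      ← coe_addUnits_sum T, add_left_comm, hTN]
  · simp only [Multiset.card_add, Multiset.card_map] at *
    omega

theorem IsSubdirectlyIrreducible.isUnitOrNil [Finite M] (hM : IsSubdirectlyIrreducible M) (x : M) :
    IsUnitOrNil x := by
  obtain ⟨n, hn, e, he, h⟩ := hM.exists_nsmul_eq x
  rw [nsmul_coe _ hn, WithZero.coe_inj] at h
  rcases he with he | he
  · rw [isIdentityElt_iff.1 he] at h
    exact Or.inl (IsAddUnit.of_nsmul_eq_zero h hn.ne')
  · exact Or.inr ⟨e, he, n, h⟩

theorem IsSubdirectlyIrreducible.gaoConstant_eq [Fintype M] (hM : IsSubdirectlyIrreducible M) :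
    gaoConstant M = davenport M + (kappa M : ℕ∞) - 1 :=
  (gaoConstant_le fun _ hd0 hd => hasDeletion_of_isUnitOrNil hM.isUnitOrNil hd0 hd).antisymm
    davenport_add_kappa_sub_one_le

end Monoid

theorem IsNilsemigroup.of_not_exists_identity {S : Type u} [AddCommSemigroup S]
    (hid : ¬ ∃ e : S, IsIdentityElt e)
    (h : IsNilsemigroup S ∨ IsAbelianGroup S ∨ IsElementary S) : IsNilsemigroup S := by
  rcases h with h | ⟨e, he, -⟩ | ⟨-, -, -, -, -, ⟨e, -, he, -⟩, -⟩
  · exact h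
  · exact absurd ⟨e, he⟩ hid
  · exact absurd ⟨e, he⟩ hid

end SemigroupZeroSum

open SemigroupZeroSum in
theorem theorem3p1 (S : Type u) [AddCommSemigroup S] [Fintype S] [Nonempty S]
    (hS : IsSubdirectlyIrreducible S) :
    gaoConstant S ≤ davenport S + (kappa S : ℕ∞) - 1 ∧
    (IsNilsemigroup S ∨ IsAbelianGroup S ∨ IsElementary S) ∧
    ((∃ e : S, IsIdentityElt e) →
      gaoConstant S = davenport S + (kappa S : ℕ∞) - 1) := by
  have heq : (∃ e : S, IsIdentityElt e) →
      gaoConstant S = davenport S + (kappa S : ℕ∞) - 1 := by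
    rintro ⟨e, he⟩
    -- The additive structure of this monoid is the given one, so all invariants stay the same.
    let _ : Zero S := ⟨e⟩
    let _ : AddCommMonoid S :=
      { (inferInstance : AddCommSemigroup S) with
        zero_add := he
        add_zero := fun a => (add_comm a e).trans (he a)
        nsmul := nsmulRec }
    exact IsSubdirectlyIrreducible.gaoConstant_eq (M := S) hS
  refine ⟨?_, hS.classification, heq⟩
  by_cases hid : ∃ e : S, IsIdentityElt e
  · exact (heq hid).le
  · exact gaoConstant_le fun _ hd0 hd =>
      hasDeletion_of_isNilsemigroup hid (.of_not_exists_identity hid hS.classification) hd0 hd
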